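/- Conventions. For an integral domain $R$ let $R^\bullet=R\setminus\{0\}$ be its multiplicative monoid of non-zero elements and $\overline R$ its integral closure in its quotient field. A commutative cancellative monoid $H$ is half-factorial if every non-unit of $H$ is a product of atoms and any two factorizations of the same non-unit into atoms have the same number of factors; a domain $R$ is half-factorial if $R^\bullet$ is. An order in a number field $K$ is a subring of $K$ that is finitely generated as a $\mathbb Z$-module and has quotient field $K$. Let $F=[p_1,\ldots,p_s]\times F^\times$ be a factorial monoid with exactly $s\ge 1$ primes $p_1,\ldots,p_s$ up to units. A submonoid $H\subset F$ is called finitely primary of rank $s$ and exponent $k\in\mathbb N_0$ if $H\setminus H^\times\subset p_1\cdots p_s F$, $(p_1\cdots p_s)^kF\subset H$, and $(p_1\cdots p_s)^iF\not\subset H$ for $0\le i<k$. (Thus exponent $0$ means $H=F$.) Lemma 4.2. Let $\mathcal O$ be an order in a number field $K$ and let $\mathfrak p$ be a non-zero prime ideal of $\mathcal O$ such that $\mathcal O_{\mathfrak p}$ is half-factorial. 1. $\overline{\mathcal O_{\mathfrak p}}$ is local, and every atom of $\mathcal O_{\mathfrak p}$ is a prime element of $\overline{\mathcal O_{\mathfrak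 p}}$. 2. Let $k$ and $\overline k$ be the residue class fields of the local rings $\mathcal O_{\mathfrak p}$ and $\overline{\mathcal O_{\mathfrak p}}$. If $\dim_k\overline k\le 3$, then $\mathcal O_{\mathfrak p}^\bullet\subset\overline{\mathcal O_{\mathfrak p}}^{\,\bullet}$ is a finitely primary monoid (of some rank), of exponent $1$ if $\mathcal O_{\mathfrak p}$ is not integrally closed, and of exponent $0$ if $\mathcal O_{\mathfrak p}$ is integrally closed. In particular, this conclusion holds whenever $[K:\mathbb Q]\in\{2,3\}$. -/

import Mathlib

open scoped nonZeroDivisors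

noncomputable section

/-- A subring `O` of a number field `K` is an order in `K` if it is finitely generated as a
`ℤ`-module and `K` is its field of fractions. -/
structure IsNumberFieldOrder {K : Type*} [Field K] [NumberField K] (O : Subring K) : Prop where
  finite : Module.Finite ℤ O
  isFractionRing : IsFractionRing O K

/-- The set of lengths of `a`: all `n` such that `a` is, up to a unit, a product of `n` atoms
(counted with multiplicity). -/
def lengthSet {M : Type*} [CommMonoid M] (a : M) : Set ℕ :=
  {n | ∃ f : Multiset M, (∀ u ∈ f, Irreducible u) ∧ Associated f.prod a ∧ f.card = n}

/-- A (cancellative) commutative monoid is half-factorial if every non-unit has exactly one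
factorization length. In particular every non-unit is a product of atoms. -/
def IsHalfFactorialMonoid (M : Type*) [CommMonoid M] : Prop :=
  ∀ a : M, ¬ IsUnit a → ∃ n : ℕ, lengthSet a = {n}

/-- A domain `R` is half-factorial if its monoid `R⁰ = R \ {0}` of non-zero elements is. -/
def IsHalfFactorialDomain (R : Type*) [CommRing R] [IsDomain R] : Prop :=
  IsHalfFactorialMonoid R⁰

/-- The submonoid `H ⊆ F` is finitely primary of rank `s ≥ 1` and exponent `k`, where
`F = [p₁, …, pₛ] × Fˣ` is factorial with exactly the primes `p₁, …, pₛ` up to units: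
`H \ Hˣ ⊆ p₁⋯pₛ F`, `(p₁⋯pₛ)ᵏ F ⊆ H`, and `k` is minimal with the latter property.
The value `k = 0` is allowed; it means `H = F`. -/
def IsFinitelyPrimary {F : Type*} [CommMonoid F] (H : Submonoid F) (s k : ℕ) : Prop :=
  0 < s ∧ ∃ p : Fin s → F,
    Function.Bijective (fun x : Fˣ × (Fin s → ℕ) => (x.1 : F) * ∏ i, p i ^ x.2 i) ∧
    (∀ a : H, ¬ IsUnit a → ∃ x : F, (a : F) = (∏ i, p i) * x) ∧
    (∀ x : F, (∏ i, p i) ^ k * x ∈ H) ∧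
    ∀ i < k, ∃ x : F, (∏ i, p i) ^ i * x ∉ H

/-- The integral closure of a domain in its quotient field. -/
abbrev domainClosure (R : Type*) [CommRing R] [IsDomain R] : Subalgebra R (FractionRing R) :=
  integralClosure R (FractionRing R)

/-- The monoid `R \ {0}`, as a submonoid of the monoid of non-zero elements of the integral
closure of `R`. -/
def nonzeroInClosure (R : Type*) [CommRing R] [IsDomain R] : Submonoid (domainClosure R)⁰ :=
  (MonoidHom.mrange (algebraMap R (domainClosure R))).comap (domainClosure R)⁰.subtype

/-- `R \ {0}` is a finitely primary monoid (of some rank) of exponent `k` inside the monoid of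
non-zero elements of the integral closure of `R`. -/
def IsFinitelyPrimaryOfExponent (R : Type*) [CommRing R] [IsDomain R] (k : ℕ) : Prop :=
  ∃ s : ℕ, IsFinitelyPrimary (nonzeroInClosure R) s k

end

/-!
Let `R` be the localization, `S` its normalization, and let `c ≠ 0` in `R` satisfy `c * S ⊆ R`.
Half-factoriality provides a length function `ℓ` on `R`, additive on products and `1` on atoms. An
element of `R` of length `n` lies in the `n`-th power of every maximal ideal of `S`, so lengths are
bounded by valuations.

* If `S` had two maximal ideals `P` and `Q`, there would be `a ∉ Q` and `b ∉ P` with `a * b`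
  divisible by a non-unit of `R`. The lengths of `c * a ^ n` and `c * b ^ n` are bounded, but
  the length of their product is not (`IsLengthFunction.isLocalRing`). So `S` is a discrete
  valuation ring.
* Elements `x`, `y` of `R` of the same valuation have `x = ε * y` with a unit `ε` of `S`, and the
  bounded lengths of `c` and `c * ε ^ N` force `ℓ x = ℓ y`. Hence length and valuation are
  proportional, and since `R` contains elements of all large valuations they agree
  (`IsLengthFunction.associated_pow_length`). In particular atoms are uniformizers of `S`.
* Let `π` be an atom and let `V` be the subspace of the residue field `E` of `S` given by the
  residues of `{x ∈ S | π * x ∈ R}`. It contains the residue field `k` of `R`. Elements of `R` of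
  valuation `n` are products of `n` atoms, so `E` is generated multiplicatively by `V`, and every
  non-zero `x ^ 2 + x + a` with `x ∈ V` and `a ∈ k` is a product of two elements of `V`. If
  `[E : k] ≤ 3` this forces `V = E`: otherwise `V ≠ k`, so `V` is spanned by `1` and an element of
  degree `3`, and `X ^ 2 + X + a` would be reducible over the finite field `k` for all `a`
  (`Submodule.eq_top_of_rank_le_three`). Nakayama's lemma then gives `π * S ⊆ R`
  (`IsLengthFunction.exists_algebraMap_eq_mul`), which is exponent at most `1`.
* The bound `[E : k] ≤ [K : ℚ]` holds because lifts of elements of `E` that are independent over `k`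
  are independent over `ℤ` (`rank_residueField_le_finrank`).
-/

section

open IsLocalRing

/-! ### Length functions of half-factorial domains -/

/-- `ℓ` is a length function on the domain `R`: it is additive on non-zero elements, it vanishes
exactly at the units, and every non-zero element of length `n + 1` splits off a factor of
length `1`. The value `ℓ 0` is irrelevant. -/
structure IsLengthFunction {R : Type*} [CommRing R] (ℓ : R → ℕ) : Prop where
  length_mul : ∀ {x y : R}, x ≠ 0 → y ≠ 0 → ℓ (x * y) = ℓ x + ℓ y
  eq_zero_iff : ∀ {x : R}, x ≠ 0 → (ℓ x = 0 ↔ IsUnit x)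
  exists_factor : ∀ {x : R} {n : ℕ}, x ≠ 0 → ℓ x = n + 1 → ∃ a y, x = a * y ∧ ℓ a = 1 ∧ ℓ y = n

theorem lengthSet_eq_of_isUnit {M : Type*} [CommMonoid M] {a : M} (ha : IsUnit a) :
    lengthSet a = {0} := by
  ext n
  constructor
  · rintro ⟨f, hf, hfa, rfl⟩
    have hu : IsUnit f.prod := hfa.isUnit_iff.2 ha
    rcases f.empty_or_exists_mem with rfl | ⟨u, hu'⟩
    · simp
    · exact absurd (isUnit_of_dvd_unit (Multiset.dvd_prod hu') hu) (hf u hu').not_isUnit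
  · rintro rfl
    exact ⟨0, by simp, by simpa using (associated_one_iff_isUnit.2 ha).symm, rfl⟩

/-- The length `ℓ x` is the unique element of `lengthSet x`; factorizations are moved between `R` and
its monoid of non-zero elements. -/
theorem IsHalfFactorialDomain.exists_isLengthFunction {R : Type*} [CommRing R] [IsDomain R]
    (h : IsHalfFactorialDomain R) : ∃ ℓ : R → ℕ, IsLengthFunction ℓ := by
  classical
  have h' : ∀ a : R⁰, ∃ n, lengthSet a = {n} := fun a => by
    by_cases ha : IsUnit a
    · exact ⟨0, lengthSet_eq_of_isUnit ha⟩
    · exact h a ha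
  choose L hL using h'
  have key : ∀ (a : R⁰) (f : Multiset R⁰), (∀ u ∈ f, Irreducible u) → Associated f.prod a →
      L a = f.card := fun a f hf hfa => by
    have : f.card ∈ lengthSet a := ⟨f, hf, hfa, rfl⟩
    rw [hL] at this
    exact this.symm
  have fac : ∀ a : R⁰, ∃ f : Multiset R⁰, (∀ u ∈ f, Irreducible u) ∧ Associated f.prod a ∧
      f.card = L a := fun a => by
    have : L a ∈ lengthSet a := by rw [hL]; rfl
    exact this
  have hmul : ∀ a b : R⁰, L (a * b) = L a + L b := fun a b => by
    obtain ⟨f, hf, hfa, hfc⟩ := fac a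
    obtain ⟨g, hg, hgb, hgc⟩ := fac b
    rw [key (a * b) (f + g) (fun u hu => (Multiset.mem_add.1 hu).elim (hf u) (hg u))
      (by rw [Multiset.prod_add]; exact hfa.mul_mul hgb), Multiset.card_add, hfc, hgc]
  have hunit : ∀ a : R⁰, IsUnit (a : R) → IsUnit a := fun a ha => by
    obtain ⟨u, hu⟩ := ha
    refine IsUnit.of_mul_eq_one ⟨(u⁻¹ : Rˣ), u⁻¹.isUnit.mem_nonZeroDivisors⟩ ?_
    ext
    simp [← hu]
  refine ⟨fun x => if hx : x ≠ 0 then L ⟨x, mem_nonZeroDivisors_of_ne_zero hx⟩ else 0, ?_, ?_, ?_⟩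
  · intro x y hx hy
    simp only [dif_pos hx, dif_pos hy, dif_pos (mul_ne_zero hx hy)]
    exact hmul ⟨x, _⟩ ⟨y, _⟩
  · intro x hx
    simp only [dif_pos hx]
    constructor
    · intro h0
      obtain ⟨f, hf, hfa, hfc⟩ := fac ⟨x, mem_nonZeroDivisors_of_ne_zero hx⟩
      rw [h0, Multiset.card_eq_zero] at hfc
      subst hfc
      exact (associated_one_iff_isUnit.1 (by simpa using hfa.symm)).map R⁰.subtype
    · intro hu
      have := key ⟨x, mem_nonZeroDivisors_of_ne_zero hx⟩ 0 (by simp)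
        (by simpa using (associated_one_iff_isUnit.2 (hunit _ hu)).symm)
      simpa using this
  · intro x n hx hn
    simp only [dif_pos hx] at hn
    obtain ⟨f, hf, ⟨u, hu⟩, hfc⟩ := fac ⟨x, mem_nonZeroDivisors_of_ne_zero hx⟩
    rw [hn] at hfc
    obtain ⟨a, g, rfl⟩ : ∃ a g, f = a ::ₘ g := by
      obtain ⟨a, ha⟩ := Multiset.card_pos_iff_exists_mem.1 (by omega : 0 < f.card)
      exact ⟨a, f.erase a, (Multiset.cons_erase ha).symm⟩
    have ha0 : (a : R) ≠ 0 := nonZeroDivisors.ne_zero a.2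
    have hg0 : ((g.prod * u : R⁰) : R) ≠ 0 := nonZeroDivisors.ne_zero (g.prod * u : R⁰).2
    refine ⟨a, (g.prod * u : R⁰), ?_, ?_, ?_⟩
    · have := congrArg Subtype.val hu
      rw [Multiset.prod_cons, mul_assoc] at this
      exact this.symm
    · rw [dif_pos ha0]
      simpa using key a {a}
        (fun u hu => Multiset.mem_singleton.1 hu ▸ hf a (Multiset.mem_cons_self a g)) (by simp)
    · rw [dif_pos hg0]
      have := key (g.prod * u) g (fun v hv => hf v (Multiset.mem_cons_of_mem hv)) ⟨u, rfl⟩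
      rw [Multiset.card_cons] at hfc
      exact this.trans (by omega)

namespace IsLengthFunction

variable {R : Type*} [CommRing R] {ℓ : R → ℕ}

theorem length_pow [IsDomain R] (h : IsLengthFunction ℓ) {x : R} (hx : x ≠ 0) (n : ℕ) :
    ℓ (x ^ n) = n * ℓ x := by
  induction n with
  | zero => simpa using (h.eq_zero_iff one_ne_zero).2 isUnit_one
  | succ n ih => rw [pow_succ, h.length_mul (pow_ne_zero n hx) hx, ih]; ring

theorem eq_one_of_irreducible (h : IsLengthFunction ℓ) {a : R} (ha : Irreducible a) :
    ℓ a = 1 := by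
  obtain ⟨n, hn⟩ := Nat.exists_eq_succ_of_ne_zero
    (mt (h.eq_zero_iff ha.ne_zero).1 ha.not_isUnit)
  obtain ⟨b, y, rfl, hb, hy⟩ := h.exists_factor ha.ne_zero hn
  have hb0 : b ≠ 0 := left_ne_zero_of_mul ha.ne_zero
  have hy0 : y ≠ 0 := right_ne_zero_of_mul ha.ne_zero
  have hbu : ¬ IsUnit b := fun hu => by simp [(h.eq_zero_iff hb0).2 hu] at hb
  rw [h.length_mul hb0 hy0, hb, (h.eq_zero_iff hy0).2 ((ha.isUnit_or_isUnit rfl).resolve_left hbu)]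

theorem mem_maximalIdeal_pow [IsLocalRing R] (h : IsLengthFunction ℓ) {x : R} (hx : x ≠ 0) :
    x ∈ maximalIdeal R ^ ℓ x := by
  induction hn : ℓ x generalizing x with
  | zero => simp
  | succ n ih =>
    obtain ⟨a, y, rfl, ha, hy⟩ := h.exists_factor hx hn
    rw [pow_succ']
    refine Ideal.mul_mem_mul ?_ (ih (right_ne_zero_of_mul hx) hy)
    rw [mem_maximalIdeal, mem_nonunits_iff, ← h.eq_zero_iff (left_ne_zero_of_mul hx), ha]
    exact one_ne_zero

end IsLengthFunction

/-! ### The normalization is local and length equals valuation -/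

namespace IsLengthFunction

variable {R S : Type*} [CommRing R] [IsLocalRing R] [CommRing S] [Algebra R S] {ℓ : R → ℕ}

/-- The length of an element is a lower bound for its valuation at any ideal over the maximal
ideal. -/
theorem algebraMap_mem_pow (h : IsLengthFunction ℓ) {P : Ideal S}
    (hP : ∀ r ∈ maximalIdeal R, algebraMap R S r ∈ P) {r : R} (hr : r ≠ 0) :
    algebraMap R S r ∈ P ^ ℓ r := by
  have := Ideal.mem_map_of_mem (algebraMap R S) (h.mem_maximalIdeal_pow hr)
  rw [Ideal.map_pow] at this
  exact Ideal.pow_right_mono (Ideal.map_le_iff_le_comap.2 hP) _ this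

/-- Multiplying a fixed element `c` by elements outside of the prime `P` over the maximal ideal
keeps the length bounded: by the `P`-adic valuation of `c`. -/
theorem exists_length_lt [IsDedekindDomain S] [FaithfulSMul R S] (h : IsLengthFunction ℓ)
    (P : Ideal S) [P.IsPrime] (hP : ∀ r ∈ maximalIdeal R, algebraMap R S r ∈ P)
    {c : R} (hc : c ≠ 0) :
    ∃ N, ∀ (r : R) (a : S), r ≠ 0 → a ∉ P → algebraMap R S r = algebraMap R S c * a →
      ℓ r < N := by
  have hc' : algebraMap R S c ≠ 0 := by simpa using hc
  obtain ⟨N, hN⟩ : ∃ N, algebraMap R S c ∉ P ^ N := by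
    by_contra! hcon
    apply hc'
    rw [← Ideal.mem_bot, ← Ideal.iInf_pow_eq_bot_of_isDomain P (Ideal.IsPrime.ne_top ‹_›)]
    exact Ideal.mem_iInf.2 hcon
  refine ⟨N, fun r a hr ha hra => ?_⟩
  by_contra! hle
  have := Ideal.pow_le_pow_right hle (h.algebraMap_mem_pow hP hr)
  rw [hra, mul_comm] at this
  exact (Ideal.IsPrime.mul_mem_pow P this).elim ha hN

/-- If the normalization `S` had two maximal ideals `P` and `Q`, one could choose `a ∉ Q` and
`b ∉ P` such that `a * b` is divisible by a non-unit of `R`. Then the lengths of `c * a ^ n` and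
`c * b ^ n` stay bounded, whereas the length of their product tends to infinity. -/
theorem isLocalRing [IsDomain R] [IsDedekindDomain S] [FaithfulSMul R S] [Algebra.IsIntegral R S]
    (h : IsLengthFunction ℓ) (hR : maximalIdeal R ≠ ⊥) {c : R} (hc : c ≠ 0)
    (hcS : ∀ s : S, ∃ r : R, algebraMap R S r = algebraMap R S c * s) : IsLocalRing S := by
  have hover : ∀ P : Ideal S, P.IsMaximal → ∀ r ∈ maximalIdeal R, algebraMap R S r ∈ P := by
    intro P hP r hr
    have := Ideal.isMaximal_comap_of_isIntegral_of_isMaximal (R := R) P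
    rw [← eq_maximalIdeal this] at hr
    exact hr
  obtain ⟨m, hm, hm0⟩ := Submodule.exists_mem_ne_zero_of_ne_bot hR
  have hm0' : algebraMap R S m ≠ 0 := by simpa using hm0
  have hc' : algebraMap R S c ≠ 0 := by simpa using hc
  obtain ⟨P, hP⟩ := Ideal.exists_maximal S
  refine .of_unique_max_ideal ⟨P, hP, fun Q hQ => ?_⟩
  by_contra hne
  obtain ⟨x, hxP, hxQ⟩ : ∃ x ∈ P, x ∉ Q := by
    by_contra! hle
    exact hne (hP.eq_of_le hQ.ne_top hle).symm
  have hPbot : P ≠ ⊥ := fun hbot => hm0' (by simpa [hbot] using hover P hP m hm)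
  obtain ⟨I, hI, hPI⟩ := (FiniteMultiplicity.of_prime_left (Ideal.prime_of_isPrime hPbot hP.isPrime)
    (b := Ideal.span {algebraMap R S m}) (by simpa using hm0)).exists_eq_pow_mul_and_not_dvd
  set e := multiplicity P (Ideal.span {algebraMap R S m})
  obtain ⟨b, hbI, hbP⟩ : ∃ b ∈ I, b ∉ P := by
    by_contra! hle
    exact hPI (Ideal.dvd_iff_le.2 hle)
  obtain ⟨y, hy⟩ : algebraMap R S m ∣ x ^ e * b := by
    rw [← Ideal.mem_span_singleton, hI]
    exact Ideal.mul_mem_mul (Ideal.pow_mem_pow hxP e) hbI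
  obtain ⟨N₁, hN₁⟩ := h.exists_length_lt Q (hover Q hQ) hc
  obtain ⟨N₂, hN₂⟩ := h.exists_length_lt P (hover P hP) hc
  have hxe : ∀ n, (x ^ e) ^ n ∉ Q := fun n hn =>
    hxQ (hQ.isPrime.mem_of_pow_mem e (hQ.isPrime.mem_of_pow_mem n hn))
  have hbe : ∀ n, b ^ n ∉ P := fun n hn => hbP (hP.isPrime.mem_of_pow_mem n hn)
  obtain ⟨r₁, hr₁⟩ := hcS ((x ^ e) ^ (N₁ + N₂))
  obtain ⟨r₂, hr₂⟩ := hcS (b ^ (N₁ + N₂))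
  obtain ⟨r₃, hr₃⟩ := hcS (y ^ (N₁ + N₂))
  have hr₁0 : r₁ ≠ 0 := by
    rintro rfl
    rw [map_zero, eq_comm, mul_eq_zero] at hr₁
    exact hxe _ (hr₁.resolve_left hc' ▸ Q.zero_mem)
  have hr₂0 : r₂ ≠ 0 := by
    rintro rfl
    rw [map_zero, eq_comm, mul_eq_zero] at hr₂
    exact hbe _ (hr₂.resolve_left hc' ▸ P.zero_mem)
  have hprod : r₁ * r₂ = m ^ (N₁ + N₂) * (c * r₃) := by
    apply FaithfulSMul.algebraMap_injective R S
    simp only [map_mul, map_pow, hr₁, hr₂, hr₃]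
    rw [mul_mul_mul_comm, ← mul_pow, hy]
    ring
  have hr₃0 : c * r₃ ≠ 0 := right_ne_zero_of_mul (hprod ▸ mul_ne_zero hr₁0 hr₂0)
  have hlen := congrArg ℓ hprod
  rw [h.length_mul hr₁0 hr₂0, h.length_mul (pow_ne_zero _ hm0) hr₃0, h.length_pow hm0] at hlen
  have hlm : 1 ≤ ℓ m := Nat.one_le_iff_ne_zero.2 (mt (h.eq_zero_iff hm0).1 hm)
  have h1 := hN₁ r₁ _ hr₁0 (hxe _) hr₁
  have h2 := hN₂ r₂ _ hr₂0 (hbe _) hr₂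
  have h3 := Nat.mul_le_mul_left (N₁ + N₂) hlm
  omega

section DVR

variable [IsDomain S] [IsDiscreteValuationRing S] [IsLocalHom (algebraMap R S)] {ϖ : S} {c : R}

theorem length_le_of_associated (h : IsLengthFunction ℓ) (hϖ : Irreducible ϖ) {r : R} {n : ℕ}
    (hr : Associated (algebraMap R S r) (ϖ ^ n)) : ℓ r ≤ n := by
  have hr0 : r ≠ 0 := by
    rintro rfl
    rw [map_zero] at hr
    exact pow_ne_zero n hϖ.ne_zero ((hr.eq_zero_iff).1 rfl)
  have := h.algebraMap_mem_pow (P := maximalIdeal S)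
    (fun r hr => map_nonunit (algebraMap R S) r hr) hr0
  rw [hϖ.maximalIdeal_eq, Ideal.span_singleton_pow, Ideal.mem_span_singleton, hr.dvd_iff_dvd_right,
    pow_dvd_pow_iff hϖ.ne_zero hϖ.not_isUnit] at this
  exact this

variable [IsDomain R] [FaithfulSMul R S]

/-- Length and valuation are proportional. Elements `x` and `y` of the same valuation differ by a
unit `ε` of `S`; the lengths of `c` and `c * ε ^ N` are bounded by the valuation of `c`,
which bounds the multiple `N * (ℓ x - ℓ y)` for all `N`. -/
theorem mul_length_eq_mul_length (h : IsLengthFunction ℓ) (hϖ : Irreducible ϖ) (hc : c ≠ 0)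
    (hcS : ∀ s : S, ∃ r : R, algebraMap R S r = algebraMap R S c * s) {x y : R} {m n : ℕ}
    (hx : Associated (algebraMap R S x) (ϖ ^ m)) (hy : Associated (algebraMap R S y) (ϖ ^ n)) :
    n * ℓ x = m * ℓ y := by
  have hne : ∀ {r : R} {k : ℕ}, Associated (algebraMap R S r) (ϖ ^ k) → r ≠ 0 := by
    rintro r k hr rfl
    rw [map_zero] at hr
    exact pow_ne_zero k hϖ.ne_zero ((hr.eq_zero_iff).1 rfl)
  have hx0 := hne hx
  have hy0 := hne hy
  have hxy : Associated (algebraMap R S (x ^ n)) (algebraMap R S (y ^ m)) := by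
    rw [map_pow, map_pow]
    refine (hx.pow_pow (n := n)).trans ?_
    rw [← pow_mul, mul_comm, pow_mul]
    exact (hy.pow_pow (n := m)).symm
  obtain ⟨ε, hε⟩ := hxy
  obtain ⟨V, hV⟩ := IsDiscreteValuationRing.associated_pow_irreducible
    (show algebraMap R S c ≠ 0 by simpa using hc) hϖ
  obtain ⟨r, hr⟩ := hcS ((ε : S) ^ (V + 1))
  have hrV : Associated (algebraMap R S r) (ϖ ^ V) := by
    rw [hr]
    refine Associated.trans ?_ hV
    exact associated_mul_unit_left _ _ (ε.isUnit.pow _)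
  have hprod : (x ^ n) ^ (V + 1) * r = (y ^ m) ^ (V + 1) * c := by
    apply FaithfulSMul.algebraMap_injective R S
    rw [map_mul, map_mul, hr, map_pow _ (y ^ m), ← hε, map_pow _ (x ^ n)]
    ring
  have hlen := congrArg ℓ hprod
  rw [h.length_mul (pow_ne_zero _ (pow_ne_zero _ hx0)) (hne hrV),
    h.length_mul (pow_ne_zero _ (pow_ne_zero _ hy0)) hc, h.length_pow (pow_ne_zero _ hx0),
    h.length_pow (pow_ne_zero _ hy0), h.length_pow hx0, h.length_pow hy0] at hlen
  have h1 := h.length_le_of_associated hϖ hV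
  have h2 := h.length_le_of_associated hϖ hrV
  rcases lt_trichotomy (n * ℓ x) (m * ℓ y) with hlt | heq | hlt
  · have := Nat.mul_le_mul_left (V + 1) hlt
    rw [Nat.succ_eq_add_one, mul_add] at this
    omega
  · exact heq
  · have := Nat.mul_le_mul_left (V + 1) hlt
    rw [Nat.succ_eq_add_one, mul_add] at this
    omega

/-- The length of an element of `R` is its valuation in `S`. The two are proportional, and
comparing `c` with `c * ϖ` shows that the factor is an integer. -/
theorem associated_pow_length (h : IsLengthFunction ℓ) (hϖ : Irreducible ϖ) (hc : c ≠ 0)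
    (hcS : ∀ s : S, ∃ r : R, algebraMap R S r = algebraMap R S c * s) {x : R} (hx : x ≠ 0) :
    Associated (algebraMap R S x) (ϖ ^ ℓ x) := by
  obtain ⟨m, hm⟩ := IsDiscreteValuationRing.associated_pow_irreducible
    (show algebraMap R S x ≠ 0 by simpa using hx) hϖ
  obtain ⟨V, hV⟩ := IsDiscreteValuationRing.associated_pow_irreducible
    (show algebraMap R S c ≠ 0 by simpa using hc) hϖ
  obtain ⟨c', hc'⟩ := hcS ϖ
  have hV' : Associated (algebraMap R S c') (ϖ ^ (V + 1)) := by
    rw [hc', pow_succ]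
    exact hV.mul_right ϖ
  have h1 := h.mul_length_eq_mul_length hϖ hc hcS hm hV
  have h2 := h.mul_length_eq_mul_length hϖ hc hcS hm hV'
  have hle := h.length_le_of_associated hϖ hm
  suffices ℓ x = m by rwa [this]
  rcases Nat.eq_zero_or_pos m with rfl | hmpos
  · omega
  have hpos : 0 < ℓ x := by
    rw [Nat.pos_iff_ne_zero, Ne, h.eq_zero_iff hx]
    intro hu
    have := hm.isUnit_iff.1 (hu.map (algebraMap R S))
    rw [isUnit_pow_iff hmpos.ne'] at this
    exact hϖ.not_isUnit this
  have h3 : m * ℓ c + ℓ x = m * ℓ c' := by rw [← h2, ← h1]; ring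
  have hdvd : m ∣ ℓ x := (Nat.dvd_add_right (Dvd.intro _ rfl)).1 (h3 ▸ Dvd.intro _ rfl)
  exact le_antisymm hle (Nat.le_of_dvd hpos hdvd)

end DVR

end IsLengthFunction

/-! ### Subspaces of cubic extensions of finite fields -/

/-- Over a finite field some polynomial `X ^ 2 + X + c` has no root, as `x ↦ x ^ 2 + x` takes the
same value at `0` and `-1` and hence is not surjective. -/
theorem exists_forall_sq_add_self_add_ne_zero (k : Type*) [Field k] [Finite k] :
    ∃ c : k, ∀ x : k, x ^ 2 + x + c ≠ 0 := by
  have hinj : ¬ Function.Injective fun x : k => x ^ 2 + x := fun hinj => by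
    have : (0 : k) = -1 := hinj (by simp)
    simp at this
  have hsurj := mt Finite.injective_iff_surjective.2 hinj
  simp only [Function.Surjective, not_forall, not_exists] at hsurj
  obtain ⟨b, hb⟩ := hsurj
  refine ⟨-b, fun x hx => hb x ?_⟩
  linear_combination hx

open Polynomial in
/-- Let `V` be a subspace containing `1` of an extension `E` of degree at most `3` of a finite
field `k`. If `V = k`, then `V = E` by `hgen`. If `V` has dimension `2`, it is spanned by `1` and
some `t` of degree `3`, and `t ^ 2 + t + c` is not a product of two elements of `V` when
`X ^ 2 + X + c` is irreducible over `k`, contrary to `hsq`. -/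
theorem Submodule.eq_top_of_rank_le_three {k E : Type*} [Field k] [Finite k] [Field E]
    [Algebra k E] (hdim : Module.rank k E ≤ 3) (V : Submodule k E) (h1 : 1 ∈ V)
    (hsq : ∀ x ∈ V, ∀ c : k, x ^ 2 + x + algebraMap k E c ≠ 0 →
      ∃ a ∈ V, ∃ b ∈ V, x ^ 2 + x + algebraMap k E c = a * b)
    (hgen : (∀ v ∈ V, ∃ a : k, algebraMap k E a = v) → ∀ x : E, x ≠ 0 → x ∈ V) : V = ⊤ := by
  have hfin : Module.Finite k E :=
    Module.rank_lt_aleph0_iff.1 (hdim.trans_lt (by exact_mod_cast Cardinal.natCast_lt_aleph0))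
  have hfr : Module.finrank k E ≤ 3 := Module.finrank_le_of_rank_le (by exact_mod_cast hdim)
  by_contra hV
  by_cases hk : ∀ v ∈ V, ∃ a : k, algebraMap k E a = v
  · refine hV (Submodule.eq_top_iff'.2 fun x => ?_)
    by_cases hx : x = 0
    · exact hx ▸ V.zero_mem
    · exact hgen hk x hx
  push Not at hk
  obtain ⟨t, htV, ht⟩ := hk
  have hli : LinearIndependent k ![1, t] := by
    rw [LinearIndependent.pair_iff]
    intro a b hab
    have hb : b = 0 := by
      by_contra hb
      apply ht (-a / b)
      have hb' : algebraMap k E b ≠ 0 := by simpa using hb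
      rw [map_div₀, map_neg, div_eq_iff hb']
      rw [Algebra.smul_def, Algebra.smul_def] at hab
      linear_combination -hab
    subst hb
    simpa using hab
  have hspan : Submodule.span k (Set.range ![1, t]) ≤ V := by
    rw [Submodule.span_le]
    rintro _ ⟨i, rfl⟩
    fin_cases i <;> assumption
  have hfs : Module.finrank k (Submodule.span k (Set.range ![1, t])) = 2 := by
    rw [finrank_span_eq_card hli, Fintype.card_fin]
  have hlt := Submodule.finrank_lt hV
  have hle := Submodule.finrank_mono hspan
  have hspanV : Submodule.span k (Set.range ![1, t]) = V :=
    Submodule.eq_of_le_of_finrank_le hspan (by omega)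
  have hint : IsIntegral k t := Algebra.IsIntegral.isIntegral t
  have hdeg : 3 ≤ (minpoly k t).natDegree := by
    have hdvd := minpoly.degree_dvd hint
    rw [show Module.finrank k E = 3 by omega, Nat.dvd_prime Nat.prime_three] at hdvd
    rcases hdvd with h | h
    · obtain ⟨a, ha⟩ := minpoly.natDegree_eq_one_iff.1 h
      exact absurd ha (ht a)
    · exact h.ge
  have hquad : ∀ a b c : k, algebraMap k E a * t ^ 2 + algebraMap k E b * t + algebraMap k E c = 0 →
      a = 0 ∧ b = 0 ∧ c = 0 := by
    intro a b c habc
    have hp : C a * X ^ 2 + C b * X + C c = 0 := by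
      by_contra hp
      have h2 : (C a * X ^ 2 + C b * X + C c : k[X]).natDegree ≤ 2 := natDegree_quadratic_le
      have := natDegree_le_natDegree (minpoly.degree_le_of_ne_zero k t hp (by simpa using habc))
      omega
    have hcoe : ∀ n, (C a * X ^ 2 + C b * X + C c : k[X]).coeff n = 0 := by simp [hp]
    refine ⟨?_, ?_, ?_⟩
    · simpa [coeff_X, coeff_C] using hcoe 2
    · simpa [coeff_X, coeff_C] using hcoe 1
    · simpa using hcoe 0
  obtain ⟨c, hc⟩ := exists_forall_sq_add_self_add_ne_zero k
  obtain ⟨u, hu, w, hw, huw⟩ := hsq t htV c fun h0 => one_ne_zero (hquad 1 1 c (by simpa using h0)).1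
  have hmem : ∀ x ∈ V, ∃ a b : k, algebraMap k E a + algebraMap k E b * t = x := by
    intro x hx
    rw [← hspanV, Matrix.range_cons, Matrix.range_cons, Matrix.range_empty, Set.union_empty,
      Set.singleton_union, Submodule.mem_span_pair] at hx
    simpa [Algebra.smul_def] using hx
  obtain ⟨a, b, rfl⟩ := hmem u hu
  obtain ⟨a', b', rfl⟩ := hmem w hw
  obtain ⟨h2, h1, h0⟩ := hquad (1 - b * b') (1 - a * b' - a' * b) (c - a * a') (by
    simp only [map_sub, map_mul, map_one]
    linear_combination huw)
  -- since `b * b' = 1`, the root of the factor `a + b * X` is `-a * b'`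
  refine hc (-a * b') ?_
  linear_combination h0 - a * b' * h1 + a * a' * h2

/-! ### Multiplication by an atom maps the normalization into the ring -/

namespace IsLengthFunction

variable {R S : Type*} [CommRing R] [IsLocalRing R] [CommRing S] [Algebra R S] {ℓ : R → ℕ}
  [IsDomain R] [IsDomain S] [IsDiscreteValuationRing S] [FaithfulSMul R S]
  [IsLocalHom (algebraMap R S)] {π c : R}

theorem irreducible_algebraMap (h : IsLengthFunction ℓ) (hc : c ≠ 0)
    (hcS : ∀ s : S, ∃ r : R, algebraMap R S r = algebraMap R S c * s)
    (hπ : ℓ π = 1) (hπ0 : π ≠ 0) : Irreducible (algebraMap R S π) := by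
  obtain ⟨ϖ, hϖ⟩ := IsDiscreteValuationRing.exists_irreducible S
  have := h.associated_pow_length hϖ hc hcS hπ0
  rw [hπ, pow_one] at this
  exact this.irreducible_iff.2 hϖ

/-- If `π ^ (n + 1) * ε` lies in `R` for a unit `ε` of `S`, it has length `n + 1` and splits off a
factor of length `1`, which is `π * ε₁` for a unit `ε₁` of `S`. -/
theorem exists_unit_factor (h : IsLengthFunction ℓ) (hc : c ≠ 0)
    (hcS : ∀ s : S, ∃ r : R, algebraMap R S r = algebraMap R S c * s)
    (hπ : ℓ π = 1) (hπ0 : π ≠ 0) {n : ℕ} {ε : S} (hε : IsUnit ε) {r : R}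
    (hr : algebraMap R S r = algebraMap R S π ^ (n + 1) * ε) :
    ∃ (ε₁ ε₂ : S) (r₁ r₂ : R), IsUnit ε₁ ∧ IsUnit ε₂ ∧ ε = ε₁ * ε₂ ∧
      algebraMap R S r₁ = algebraMap R S π * ε₁ ∧
      algebraMap R S r₂ = algebraMap R S π ^ n * ε₂ := by
  have hϖ := h.irreducible_algebraMap hc hcS hπ hπ0
  have hass : Associated (algebraMap R S r) (algebraMap R S π ^ (n + 1)) := by
    rw [hr]
    exact associated_mul_unit_left _ _ hε
  have hr0 : r ≠ 0 := by
    rintro rfl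
    rw [map_zero] at hass
    exact pow_ne_zero _ hϖ.ne_zero ((hass.eq_zero_iff).1 rfl)
  have hlen : ℓ r = n + 1 := by
    have := (h.associated_pow_length hϖ hc hcS hr0).symm.trans hass
    refine le_antisymm ((pow_dvd_pow_iff hϖ.ne_zero hϖ.not_isUnit).1 this.dvd)
      ((pow_dvd_pow_iff hϖ.ne_zero hϖ.not_isUnit).1 this.dvd')
  obtain ⟨a, y, rfl, ha, hy⟩ := h.exists_factor hr0 hlen
  obtain ⟨u, hu⟩ := (h.associated_pow_length hϖ hc hcS (left_ne_zero_of_mul hr0)).symm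
  obtain ⟨w, hw⟩ := (h.associated_pow_length hϖ hc hcS (right_ne_zero_of_mul hr0)).symm
  rw [ha, pow_one] at hu
  rw [hy] at hw
  refine ⟨u, w, a, y, u.isUnit, w.isUnit, ?_, hu.symm, hw.symm⟩
  apply mul_left_cancel₀ (pow_ne_zero (n + 1) hϖ.ne_zero)
  rw [← hr, map_mul, ← hu, ← hw]
  ring

/-- Let `A = {x ∈ S | π * x ∈ R}`. Its image `V` in the residue field of `S` is a subspace
containing `1`, and length-`2` elements of `R` show that each non-zero element of the image of
`{x ∈ S | π ^ 2 * x ∈ R}` is a product of two elements of `V`; moreover every unit of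
`S` is a product of units in `A`. Hence `V` is everything, and `A = S` by Nakayama. -/
theorem exists_algebraMap_eq_mul (h : IsLengthFunction ℓ) (hc : c ≠ 0)
    (hcS : ∀ s : S, ∃ r : R, algebraMap R S r = algebraMap R S c * s)
    (hπ : ℓ π = 1) (hπ0 : π ≠ 0) [Module.Finite R S] [Finite (ResidueField R)]
    (hdim : Module.rank (ResidueField R) (ResidueField S) ≤ 3) (s : S) :
    ∃ r : R, algebraMap R S r = algebraMap R S π * s := by
  have hϖ := h.irreducible_algebraMap hc hcS hπ hπ0
  let A : Submodule R S :=
    (LinearMap.range (Algebra.linearMap R S)).comap (LinearMap.mulLeft R (algebraMap R S π))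
  have hA : ∀ x, x ∈ A ↔ ∃ r, algebraMap R S r = algebraMap R S π * x := fun x => Iff.rfl
  have hAR : ∀ r, algebraMap R S r ∈ A := fun r => (hA _).2 ⟨π * r, map_mul _ _ _⟩
  let V : Submodule (ResidueField R) (ResidueField S) :=
    { carrier := residue S '' A
      zero_mem' := ⟨0, A.zero_mem, map_zero _⟩
      add_mem' := by
        rintro _ _ ⟨x, hx, rfl⟩ ⟨y, hy, rfl⟩
        exact ⟨x + y, A.add_mem hx hy, map_add _ _ _⟩
      smul_mem' := by
        rintro a _ ⟨x, hx, rfl⟩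
        obtain ⟨a, rfl⟩ := residue_surjective a
        refine ⟨a • x, A.smul_mem a hx, ?_⟩
        rw [Algebra.smul_def, Algebra.smul_def, map_mul, ResidueField.algebraMap_residue] }
  have hV : V = ⊤ := by
    refine Submodule.eq_top_of_rank_le_three hdim V ⟨1, ?_, map_one _⟩ ?_ ?_
    · simpa using hAR 1
    · rintro _ ⟨x, ⟨r, hr⟩, rfl⟩ a ha
      obtain ⟨a, rfl⟩ := residue_surjective a
      rw [ResidueField.algebraMap_residue, ← map_pow, ← map_add, ← map_add] at ha ⊢
      have hu := (residue_ne_zero_iff_isUnit _).1 ha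
      have hr' : algebraMap R S r = algebraMap R S π * x := hr
      obtain ⟨ε₁, ε₂, r₁, r₂, -, -, hε, h₁, h₂⟩ := h.exists_unit_factor hc hcS hπ hπ0 (n := 1)
        hu (r := r ^ 2 + π * r + π ^ 2 * a) (by
          simp only [map_add, map_mul, map_pow, hr']
          ring)
      rw [pow_one] at h₂
      exact ⟨_, ⟨ε₁, ⟨r₁, h₁⟩, rfl⟩, _, ⟨ε₂, ⟨r₂, h₂⟩, rfl⟩, by rw [hε, map_mul]⟩
    · intro hk
      -- A unit `ε` with `π ^ n * ε ∈ R` is a product of `n` units in `A`, so its residue lies in the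
      -- residue field of `R`. For `n = ℓ c` this applies to every unit of `S`.
      have hprod : ∀ (n : ℕ) (ε : S) (r : R), IsUnit ε →
          algebraMap R S r = algebraMap R S π ^ n * ε →
          ∃ a, algebraMap (ResidueField R) (ResidueField S) a = residue S ε := by
        intro n
        induction n with
        | zero =>
          intro ε r _ hr
          exact ⟨residue R r, by simp [hr]⟩
        | succ n ih =>
          intro ε r hε hr
          obtain ⟨ε₁, ε₂, r₁, r₂, -, hε₂, rfl, h₁, h₂⟩ := h.exists_unit_factor hc hcS hπ hπ0 hε hr
          obtain ⟨a, ha⟩ := hk (residue S ε₁) ⟨ε₁, ⟨r₁, h₁⟩, rfl⟩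
          obtain ⟨b, hb⟩ := ih ε₂ r₂ hε₂ h₂
          exact ⟨a * b, by rw [map_mul, map_mul, ha, hb]⟩
      intro x hx
      obtain ⟨x, rfl⟩ := residue_surjective x
      obtain ⟨u, hu⟩ := h.associated_pow_length hϖ hc hcS hc
      obtain ⟨r, hr⟩ := hcS (u * x)
      obtain ⟨a, ha⟩ := hprod (ℓ c) x r ((residue_ne_zero_iff_isUnit _).1 hx)
        (by rw [hr, ← hu, mul_assoc])
      obtain ⟨a, rfl⟩ := residue_surjective a
      exact ⟨algebraMap R S a, hAR a, by rw [← ha, ResidueField.algebraMap_residue]⟩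
  -- `S = A + π * S` is contained in `A + maximalIdeal R • S`
  have htop : (⊤ : Submodule R S) ≤ A := by
    refine Submodule.le_of_le_smul_of_le_jacobson_bot (I := maximalIdeal R) Module.Finite.fg_top
      (maximalIdeal_le_jacobson _) fun x _ => ?_
    obtain ⟨y, hy, hyx⟩ : residue S x ∈ V := hV ▸ Submodule.mem_top
    have hxy : x - y ∈ maximalIdeal S := by
      rw [← residue_eq_zero_iff, map_sub, hyx, sub_self]
    rw [hϖ.maximalIdeal_eq, Ideal.mem_span_singleton] at hxy
    obtain ⟨z, hz⟩ := hxy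
    have hπm : π ∈ maximalIdeal R := fun hu => hϖ.not_isUnit (hu.map _)
    refine Submodule.mem_sup.2 ⟨y, hy, π • z, Submodule.smul_mem_smul hπm Submodule.mem_top, ?_⟩
    rw [Algebra.smul_def, ← hz]
    ring
  exact (hA s).1 (htop Submodule.mem_top)

end IsLengthFunction

/-! ### Finitely primary monoids in discrete valuation rings -/

/-- If the normalization of `R` is a discrete valuation ring, then `R \ {0}` is finitely primary of
rank one, with exponent the least `k` such that multiplication by `ϖ ^ k` maps the normalization
into `R`. -/
theorem isFinitelyPrimaryOfExponent_of_irreducible {R : Type*} [CommRing R] [IsDomain R]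
    [IsDiscreteValuationRing (domainClosure R)] {ϖ : domainClosure R}
    (hϖ : Irreducible ϖ) {k : ℕ}
    (hk : ∀ x : domainClosure R, ∃ r : R, algebraMap R (domainClosure R) r = ϖ ^ k * x)
    (hmin : ∀ i < k, ∃ x : domainClosure R, x ≠ 0 ∧
      ∀ r : R, algebraMap R (domainClosure R) r ≠ ϖ ^ i * x) :
    IsFinitelyPrimaryOfExponent R k := by
  let q : (domainClosure R)⁰ := ⟨ϖ, mem_nonZeroDivisors_of_ne_zero hϖ.ne_zero⟩
  refine ⟨1, one_pos, fun _ => q, ⟨?_, ?_⟩, ?_, ?_, ?_⟩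
  · rintro ⟨u, m⟩ ⟨w, n⟩ huw
    have huw' := congrArg Subtype.val huw
    simp only [Finset.univ_unique, Finset.prod_singleton, Submonoid.coe_mul,
      SubmonoidClass.coe_pow] at huw'
    have hmn : m default = n default :=
      IsDiscreteValuationRing.unit_mul_pow_congr_pow hϖ hϖ (unitsNonZeroDivisorsEquiv u)
        (unitsNonZeroDivisorsEquiv w) _ _ huw'
    have hmn' : m = n := by
      ext i
      rw [Subsingleton.elim i default, hmn]
    subst hmn'
    have := mul_right_cancel₀ (pow_ne_zero _ hϖ.ne_zero) huw'
    exact Prod.ext (Units.ext (Subtype.ext this)) rfl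
  · intro x
    obtain ⟨n, u, hx⟩ := IsDiscreteValuationRing.eq_unit_mul_pow_irreducible
      (nonZeroDivisors.ne_zero x.2) hϖ
    refine ⟨⟨unitsNonZeroDivisorsEquiv.symm u, fun _ => n⟩, Subtype.ext ?_⟩
    simp only [Finset.univ_unique, Finset.prod_singleton, Submonoid.coe_mul,
      SubmonoidClass.coe_pow]
    exact hx.symm
  · rintro ⟨⟨a, ha⟩, hra⟩ hau
    obtain ⟨r, hr⟩ := id hra
    obtain rfl : algebraMap R (domainClosure R) r = a := hr
    have hr : ¬ IsUnit r := by
      rintro ⟨u, rfl⟩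
      have hmem : ∀ w : Rˣ, algebraMap R (domainClosure R) w ∈ (domainClosure R)⁰ :=
        fun w => (w.isUnit.map _).mem_nonZeroDivisors
      refine hau (IsUnit.of_mul_eq_one ⟨⟨algebraMap R _ (u⁻¹ : Rˣ), hmem _⟩, ⟨_, rfl⟩⟩ ?_)
      ext1
      ext1
      change algebraMap R (domainClosure R) u * algebraMap R (domainClosure R) (u⁻¹ : Rˣ) = 1
      rw [← map_mul, Units.mul_inv, map_one]
    have hr' : algebraMap R (domainClosure R) r ∈ maximalIdeal (domainClosure R) :=
      fun hu => hr (isUnit_of_map_unit (algebraMap R (domainClosure R)) r hu)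
    rw [hϖ.maximalIdeal_eq, Ideal.mem_span_singleton] at hr'
    obtain ⟨x, hx⟩ := hr'
    have ha0 : algebraMap R (domainClosure R) r ≠ 0 := nonZeroDivisors.ne_zero ha
    refine ⟨⟨x, mem_nonZeroDivisors_of_ne_zero (right_ne_zero_of_mul (hx ▸ ha0))⟩, ?_⟩
    ext1
    simpa using hx
  · intro x
    obtain ⟨r, hr⟩ := hk x
    exact ⟨r, by simpa [q] using hr⟩
  · intro i hi
    obtain ⟨x, hx0, hx⟩ := hmin i hi
    refine ⟨⟨x, mem_nonZeroDivisors_of_ne_zero hx0⟩, ?_⟩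
    rintro ⟨r, hr⟩
    exact hx r (by simpa [q] using hr)

/-! ### Residue degree, conductor, and localizations of orders -/

/-- The residue extension has degree at most `[L : ℚ]`: lifts of elements that are independent over
the residue field of `R` are independent over `ℤ`, since a relation with coprime integral
coefficients reduces to a non-trivial one. -/
theorem rank_residueField_le_finrank {R S L : Type*} [CommRing R] [IsLocalRing R] [CommRing S]
    [IsLocalRing S] [Algebra R S] [IsLocalHom (algebraMap R S)] [Field L] [NumberField L]
    [Algebra S L] [FaithfulSMul S L] :
    Module.rank (ResidueField R) (ResidueField S) ≤ Module.finrank ℚ L := by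
  refine rank_le fun s hs => ?_
  have hlin : LinearIndependent ℤ fun i : s =>
      algebraMap S L (Function.surjInv residue_surjective (i : ResidueField S)) := by
    rw [linearIndependent_iff']
    intro t g hg i hi
    by_contra hgi
    obtain ⟨g', hg', hgcd⟩ := Finset.extract_gcd g ⟨i, hi⟩
    have hd : t.gcd g ≠ 0 := fun h0 => hgi (by rw [hg' i hi, h0, zero_mul])
    have hsum : ∑ j ∈ t,
        (g' j : S) * Function.surjInv residue_surjective (j : ResidueField S) = 0 := by
      apply FaithfulSMul.algebraMap_injective S L
      apply mul_left_cancel₀ (Int.cast_ne_zero.2 hd : ((t.gcd g : ℤ) : L) ≠ 0)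
      rw [map_zero, mul_zero, map_sum, Finset.mul_sum, ← hg]
      refine Finset.sum_congr rfl fun j hj => ?_
      rw [hg' j hj, map_mul, map_intCast, zsmul_eq_mul, Int.cast_mul, mul_assoc]
    have hres : ∑ j ∈ t, (g' j : ResidueField R) • (j : ResidueField S) = 0 := by
      have := congrArg (residue S) hsum
      simpa [Function.surjInv_eq, Algebra.smul_def] using this
    have hzero := linearIndependent_iff'.1 hs t _ hres
    have hdvd : (ringChar (ResidueField R) : ℤ) ∣ t.gcd g' :=
      Finset.dvd_gcd fun j hj => (CharP.intCast_eq_zero_iff _ _ _).1 (hzero j hj)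
    rw [hgcd, ← CharP.intCast_eq_zero_iff (ResidueField R)] at hdvd
    simp at hdvd
  rw [LinearIndependent.iff_fractionRing ℤ ℚ] at hlin
  simpa using hlin.fintype_card_le_finrank

/-- A domain whose normalization is a finite module has a non-zero conductor. -/
theorem exists_forall_algebraMap_eq_mul_domainClosure (R : Type*) [CommRing R] [IsDomain R]
    [Module.Finite R (domainClosure R)] :
    ∃ c : R, c ≠ 0 ∧ ∀ s : domainClosure R, ∃ r : R,
      algebraMap R (domainClosure R) r = algebraMap R (domainClosure R) c * s := by
  classical
  obtain ⟨T, hT⟩ := Module.Finite.fg_top (R := R) (M := domainClosure R)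
  obtain ⟨c, hc⟩ := IsLocalization.exist_integer_multiples_of_finset R⁰
    (T.image ((↑) : domainClosure R → FractionRing R))
  refine ⟨c, nonZeroDivisors.ne_zero c.2, fun s => ?_⟩
  have hs : s ∈ Submodule.span R (T : Set (domainClosure R)) := hT ▸ Submodule.mem_top
  induction hs using Submodule.span_induction with
  | mem x hx =>
    obtain ⟨r, hr⟩ := hc x (Finset.mem_image_of_mem _ hx)
    refine ⟨r, Subtype.ext ?_⟩
    rw [← Algebra.smul_def]
    exact hr
  | zero => exact ⟨0, by simp⟩
  | add x y _ _ hx hy =>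
    obtain ⟨r, hr⟩ := hx
    obtain ⟨r', hr'⟩ := hy
    exact ⟨r + r', by rw [map_add, hr, hr', mul_add]⟩
  | smul a x _ hx =>
    obtain ⟨r, hr⟩ := hx
    exact ⟨a * r, by rw [map_mul, hr, Algebra.smul_def, mul_left_comm]⟩

namespace IsNumberFieldOrder

variable {K : Type*} [Field K] [NumberField K] {O : Subring K}

theorem dimensionLEOne (hO : IsNumberFieldOrder O) : Ring.DimensionLEOne O := by
  have := hO.finite
  exact Ring.DimensionLEOne.of_isIntegral ℤ O

theorem nonempty_fractionRing_ringEquiv (hO : IsNumberFieldOrder O) (p : Ideal O) [p.IsPrime]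
    (R : Type*) [CommRing R] [Algebra O R] [IsLocalization.AtPrime R p] [IsDomain R] :
    Nonempty (K ≃+* FractionRing R) := by
  have := hO.isFractionRing
  let : Algebra R K :=
    IsLocalization.localizationAlgebraOfSubmonoidLe R K p.primeCompl O⁰
      p.primeCompl_le_nonZeroDivisors
  have : IsScalarTower O R K :=
    IsLocalization.localization_isScalarTower_of_submonoid_le R K
      p.primeCompl O⁰ p.primeCompl_le_nonZeroDivisors
  have : IsFractionRing R K :=
    IsFractionRing.isFractionRing_of_isDomain_of_isLocalization p.primeCompl _ K
  exact ⟨(FractionRing.algEquiv R K).toRingEquiv.symm⟩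

theorem isNoetherianRing_localization (hO : IsNumberFieldOrder O) (p : Ideal O) [p.IsPrime]
    (R : Type*) [CommRing R] [Algebra O R] [IsLocalization.AtPrime R p] : IsNoetherianRing R := by
  have := hO.finite
  have : IsNoetherianRing O := IsNoetherianRing.of_finite ℤ O
  exact IsLocalization.isNoetherianRing p.primeCompl _ this

theorem finite_residueField (hO : IsNumberFieldOrder O) (p : Ideal O) [p.IsPrime]
    (R : Type*) [CommRing R] [Algebra O R] [IsLocalization.AtPrime R p]
    [IsLocalRing R] (hp : p ≠ ⊥) : Finite (ResidueField R) := by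
  have := hO.finite
  have := hO.dimensionLEOne
  have hmax : p.IsMaximal := Ideal.IsPrime.isMaximal ‹_› hp
  have := Ideal.finiteQuotientOfFreeOfNeBot p hp
  exact Finite.of_equiv _
    (IsLocalization.AtPrime.equivQuotMaximalIdeal p R).toEquiv

/-- In a number field `L`, the integral closure of the localization `R` is contained in the
`R`-module generated by the algebraic integers, which is finitely generated. -/
theorem finite_integralClosure (hO : IsNumberFieldOrder O) (p : Ideal O) [p.IsPrime]
    (R : Type*) [CommRing R] [Algebra O R] [IsLocalization.AtPrime R p] (L : Type*) [Field L]
    [NumberField L] [Algebra O L] [Algebra R L] [IsScalarTower O R L] :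
    Module.Finite R (integralClosure R L) := by
  have := hO.finite
  have := hO.isNoetherianRing_localization p R
  obtain ⟨T, hT⟩ := (Module.Finite.iff_fg (N := (integralClosure ℤ L).toSubmodule)).1
    (IsIntegralClosure.finite ℤ ℚ L (integralClosure ℤ L))
  have hle : (integralClosure R L).toSubmodule ≤ Submodule.span R (T : Set L) := by
    intro x hx
    obtain ⟨m, hm⟩ := IsIntegral.exists_multiple_integral_of_isLocalization (R := O)
      p.primeCompl x hx
    have hmx : m • x ∈ Submodule.span R (T : Set L) := by
      refine Submodule.span_subset_span ℤ R (T : Set L) ?_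
      rw [hT]
      exact isIntegral_trans (A := O) _ hm
    obtain ⟨u, hu⟩ := IsLocalization.map_units R m
    have : x = ((u⁻¹ : Rˣ) : R) • (m • x) := by
      rw [Submonoid.smul_def, ← algebraMap_smul R (m : O) x, ← hu, smul_smul, Units.inv_mul,
        one_smul]
    rw [this]
    exact Submodule.smul_mem _ _ hmx
  have hN : IsNoetherian R (Submodule.span R (T : Set L)) :=
    isNoetherian_span_of_finite R T.finite_toSet
  exact Module.Finite.of_fg (isNoetherian_submodule.1 hN _ hle)

theorem isDedekindDomain_domainClosure (hO : IsNumberFieldOrder O) (p : Ideal O) [p.IsPrime]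
    (R : Type*) [CommRing R] [Algebra O R] [IsLocalization.AtPrime R p]
    [IsDomain R] [NumberField (FractionRing R)] :
    IsDedekindDomain (domainClosure R) := by
  have := hO.isNoetherianRing_localization p R
  have := hO.finite_integralClosure p R (FractionRing R)
  have := hO.dimensionLEOne
  have : Ring.DimensionLEOne R :=
    Ring.DimensionLEOne.localization _ p.primeCompl_le_nonZeroDivisors
  have hnoeth : IsNoetherianRing (domainClosure R) :=
    IsNoetherianRing.of_finite R _
  have hdim : Ring.DimensionLEOne (domainClosure R) :=
    Ring.DimensionLEOne.integralClosure _ _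
  have hint : IsIntegrallyClosed (domainClosure R) :=
    integralClosure.isIntegrallyClosedOfFiniteExtension (FractionRing R)
  exact { toIsDomain := inferInstance, toIsDedekindRing := { hnoeth, hdim, hint with } }

end IsNumberFieldOrder

/-! ### Half-factorial localizations of orders -/

/-- The statement for an arbitrary model `R` of the localization of `O` at `p`. -/
theorem IsNumberFieldOrder.halfFactorial_localization {K : Type*} [Field K] [NumberField K]
    {O : Subring K} (hO : IsNumberFieldOrder O) (p : Ideal O) [p.IsPrime] (hp : p ≠ ⊥)
    (R : Type*) [CommRing R] [IsDomain R] [IsLocalRing R] [Algebra O R]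
    [IsLocalization.AtPrime R p] (hHF : IsHalfFactorialDomain R) :
    ∃ _ : IsLocalRing (domainClosure R),
      (∀ a : R, Irreducible a → Prime (algebraMap R (domainClosure R) a)) ∧
      (Module.rank (ResidueField R) (ResidueField (domainClosure R)) ≤ 3 →
        (¬ IsIntegrallyClosed R → IsFinitelyPrimaryOfExponent R 1) ∧
        (IsIntegrallyClosed R → IsFinitelyPrimaryOfExponent R 0)) ∧
      (Module.finrank ℚ K = 2 ∨ Module.finrank ℚ K = 3 →
        (¬ IsIntegrallyClosed R → IsFinitelyPrimaryOfExponent R 1) ∧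
        (IsIntegrallyClosed R → IsFinitelyPrimaryOfExponent R 0)) := by
  obtain ⟨e⟩ := hO.nonempty_fractionRing_ringEquiv p R
  have hL : NumberField (FractionRing R) := .of_ringEquiv K _ e
  have hrank : Module.finrank ℚ (FractionRing R) = Module.finrank ℚ K :=
    e.toRatAlgEquiv.toLinearEquiv.finrank_eq.symm
  have := hO.finite_integralClosure p R (FractionRing R)
  have := hO.isDedekindDomain_domainClosure p R
  have := hO.finite_residueField p R hp
  obtain ⟨ℓ, h⟩ := hHF.exists_isLengthFunction
  obtain ⟨c, hc, hcS⟩ := exists_forall_algebraMap_eq_mul_domainClosure R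
  have hfield : maximalIdeal R ≠ ⊥ :=
    mt isField_iff_maximalIdeal_eq.2 (IsLocalization.AtPrime.not_isField O hp _)
  have hloc := h.isLocalRing hfield hc hcS
  obtain ⟨m, hm, hm0⟩ := Submodule.exists_mem_ne_zero_of_ne_bot hfield
  have hmS : algebraMap _ (domainClosure R) m ≠ 0 := by simpa using hm0
  have hdvr : IsDiscreteValuationRing (domainClosure R) := by
    refine ((IsDiscreteValuationRing.TFAE _ fun hF => ?_).out 0 2).2 ‹_›
    have := map_nonunit (algebraMap _ (domainClosure R)) m hm
    rw [isField_iff_maximalIdeal_eq.1 hF, Ideal.mem_bot] at this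
    exact hmS this
  obtain ⟨n, hn⟩ := Nat.exists_eq_succ_of_ne_zero (mt (h.eq_zero_iff hm0).1 hm)
  obtain ⟨π, y, hmπ, hπ, -⟩ := h.exists_factor hm0 hn
  have hπ0 : π ≠ 0 := left_ne_zero_of_mul (hmπ ▸ hm0)
  have hϖ := h.irreducible_algebraMap hc hcS hπ hπ0
  have hclosed : IsIntegrallyClosed R ↔
      ∀ x : domainClosure R, ∃ r : R, algebraMap R _ r = x := by
    rw [isIntegrallyClosed_iff (FractionRing R)]
    constructor
    · intro hcl x
      obtain ⟨r, hr⟩ := hcl x.2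
      exact ⟨r, Subtype.ext hr⟩
    · intro hcl x hx
      obtain ⟨r, hr⟩ := hcl ⟨x, hx⟩
      exact ⟨r, congrArg Subtype.val hr⟩
  have hmain : Module.rank (ResidueField R) (ResidueField (domainClosure R)) ≤ 3 →
      (¬ IsIntegrallyClosed R → IsFinitelyPrimaryOfExponent R 1) ∧
        (IsIntegrallyClosed R → IsFinitelyPrimaryOfExponent R 0) := by
    intro hdim
    refine ⟨fun hn => ?_, fun hcl => ?_⟩
    · refine isFinitelyPrimaryOfExponent_of_irreducible hϖ (fun x => ?_) fun i hi => ?_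
      · rw [pow_one]
        exact h.exists_algebraMap_eq_mul hc hcS hπ hπ0 hdim x
      · obtain rfl : i = 0 := by omega
        rw [hclosed] at hn
        push Not at hn
        obtain ⟨x, hx⟩ := hn
        refine ⟨x, fun hx0 => hx 0 (by rw [map_zero, hx0]), fun r => ?_⟩
        rw [pow_zero, one_mul]
        exact hx r
    · refine isFinitelyPrimaryOfExponent_of_irreducible hϖ (fun x => ?_) fun i hi => ?_
      · rw [pow_zero, one_mul]
        exact hclosed.1 hcl x
      · omega
  refine ⟨hloc, fun a ha => ?_, hmain, fun hK => hmain ?_⟩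
  · exact (h.irreducible_algebraMap hc hcS (h.eq_one_of_irreducible ha) ha.ne_zero).prime
  · refine (rank_residueField_le_finrank (L := FractionRing R)).trans ?_
    rw [hrank]
    exact_mod_cast (by omega : Module.finrank ℚ K ≤ 3)

end

theorem lemma4p2 {K : Type*} [Field K] [NumberField K] (O : Subring K)
    (hO : IsNumberFieldOrder O) (p : Ideal O) [p.IsPrime] (hp : p ≠ ⊥)
    (hHF : IsHalfFactorialDomain (Localization.AtPrime p)) :
    ∃ _ : IsLocalRing (domainClosure (Localization.AtPrime p)),
      (∀ a : Localization.AtPrime p, Irreducible a →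
        Prime (algebraMap (Localization.AtPrime p)
          (domainClosure (Localization.AtPrime p)) a)) ∧
      (Module.rank (IsLocalRing.ResidueField (Localization.AtPrime p))
          (IsLocalRing.ResidueField (domainClosure (Localization.AtPrime p))) ≤ 3 →
        (¬ IsIntegrallyClosed (Localization.AtPrime p) →
          IsFinitelyPrimaryOfExponent (Localization.AtPrime p) 1) ∧
        (IsIntegrallyClosed (Localization.AtPrime p) →
          IsFinitelyPrimaryOfExponent (Localization.AtPrime p) 0)) ∧
      (Module.finrank ℚ K = 2 ∨ Module.finrank ℚ K = 3 →
        (¬ IsIntegrallyClosed (Localization.AtPrime p) →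
          IsFinitelyPrimaryOfExponent (Localization.AtPrime p) 1) ∧
        (IsIntegrallyClosed (Localization.AtPrime p) →
          IsFinitelyPrimaryOfExponent (Localization.AtPrime p) 0)) :=
  hO.halfFactorial_localization p hp (Localization.AtPrime p) hHF
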